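/- Theorem. For integers $n,g\ge 0$ let $A(n,g)$ be the number of rooted one-face maps with $n$ edges and genus $g$, up to equivalence. Here a rooted one-face map with $n\ge 1$ edges is encoded by permutations $\alpha,\beta,\gamma$ of its $2n$ labelled half-edges, where $\alpha$ is an involution without fixed points (its cycles are the edges), the cycles of $\beta$ are the vertices, and $\gamma=\alpha\beta$ is a single cycle of length $2n$ (the unique face); the half-edge with label $1$ is the root. Two such maps are equivalent if some permutation $\pi$ with $\pi(1)=1$ satisfies $\alpha'=\pi\alpha\pi^{-1}$ and $\gamma'=\pi\gamma\pi^{-1}$. The genus $g$ is given by Euler's formula $v-n+1=2-2g$, where $v$ is the number of vertices, that is, of cycles of $\beta$ including fixed points. For $n=0$ the only map is a single vertex ($v=1$), so that $A(0,0)=1$. Then $A(n,g)=0$ whenever $2g>n$, and for every $n\ge 0$ the polynomial $A_n(x)=\sum_{g\ge 0}A(n,g)\,x^{n+1-2g}$ satisfies, in $\mathbb{Q}[x]$, $$A_n(x)=\frac{(2n)!}{2^n\,n!}\sum_{k=0}^{n}\binom{n}{k}\binom{x+n-k}{n+1},$$ where $\binom{y}{m}=\frac{y(y-1)\cdots(y-m+1)}{m!}$.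 Moreover $A_n(-x)=(-1)^{n+1}A_n(x)$. -/

import Mathlib

open Polynomial

/-- A labelled one-face map with `n` edges, encoded as a triple of permutations of its `2 n`
half-edges: the cycles of the fixed-point-free involution `α` are the edges, the cycles of `β` are
the vertices (with the cyclic order of the half-edges around each of them), and `γ = α β`, which
travels along the boundary, is a single cycle through all the half-edges (the unique face).
The root of the map is the half-edge with the first label. The only map without edges is the map
that consists of one isolated vertex; its triple is the triple of empty permutations. -/
structure RootedOneFaceMap (n : ℕ) where
  α : Equiv.Perm (Fin (2 * n))
  β : Equiv.Perm (Fin (2 * n))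
  γ : Equiv.Perm (Fin (2 * n))
  α_involutive : ∀ i, α (α i) = i
  α_fixedPointFree : ∀ i, α i ≠ i
  γ_eq : γ = α * β
  γ_longCycle : γ.IsCycleOn Set.univ

namespace RootedOneFaceMap

variable {n : ℕ}

/-- Two rooted one-face maps are equivalent if a relabelling `π` of the half-edges that fixes the
root (the half-edge with label `0`) carries one to the other. -/
def Equivalent (M N : RootedOneFaceMap n) : Prop :=
  ∃ π : Equiv.Perm (Fin (2 * n)),
    N.α = π * M.α * π⁻¹ ∧ N.γ = π * M.γ * π⁻¹ ∧ ∀ i : Fin (2 * n), (i : ℕ) = 0 → π i = i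

theorem equivalent_equivalence : Equivalence (Equivalent (n := n)) where
  refl M := ⟨1, by simp, by simp, by simp⟩
  symm := by
    rintro M N ⟨π, hα, hγ, h0⟩
    refine ⟨π⁻¹, ?_, ?_, fun i hi => ?_⟩
    · rw [hα]; group
    · rw [hγ]; group
    · rw [Equiv.Perm.inv_eq_iff_eq, h0 i hi]
  trans := by
    rintro M N P ⟨π, hα, hγ, h0⟩ ⟨ρ, kα, kγ, k0⟩
    refine ⟨ρ * π, ?_, ?_, fun i hi => ?_⟩
    · rw [kα, hα]; group
    · rw [kγ, hγ]; group
    · rw [Equiv.Perm.mul_apply, h0 i hi, k0 i hi]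

/-- The setoid of equivalence of rooted one-face maps. -/
def equivSetoid (n : ℕ) : Setoid (RootedOneFaceMap n) where
  r := Equivalent
  iseqv := equivalent_equivalence

/-- The number of vertices: the number of cycles of `β`, fixed points included. The vertex of the
map without edges is incident to no half-edge and is counted separately. -/
noncomputable def numVertices (M : RootedOneFaceMap n) : ℕ :=
  if n = 0 then 1 else Nat.card (Quotient (Equiv.Perm.SameCycle.setoid M.β))

/-- The map has genus `g`: Euler's formula `v - n + 1 = 2 - 2 g`. -/
def HasGenus (M : RootedOneFaceMap n) (g : ℕ) : Prop :=
  (M.numVertices : ℤ) - n + 1 = 2 - 2 * g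

end RootedOneFaceMap

/-- `A(n, g)`: the number of rooted one-face maps of genus `g` with `n` edges,
up to equivalence. -/
noncomputable def oneFaceMapCount (n g : ℕ) : ℕ :=
  Set.ncard {c : Quotient (RootedOneFaceMap.equivSetoid n) |
    ∃ M : RootedOneFaceMap n, M.HasGenus g ∧ Quotient.mk _ M = c}

/-- The generating polynomial `A_n(x) = ∑_g A(n, g) x ^ (n + 1 - 2 g)`. The sum runs over the `g`
with `2 g ≤ n`, for which the exponent is positive. -/
noncomputable def genusPolynomial (n : ℕ) : ℚ[X] :=
  ∑ g ∈ Finset.range (n / 2 + 1), (oneFaceMapCount n g : ℚ[X]) * X ^ (n + 1 - 2 * g)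

/-! The number `N ^ v` counts the colourings of the `v` vertices with `N` colours, so a polynomial
identity in `x` follows from counting coloured maps for every natural number `N`. A labelled map is
a pairing `α` together with a long cycle `γ`, and its vertices are the cycles of `α * γ`.

The heart is a formula for an arbitrary permutation `σ` of `m ≥ 1` points with permutation matrix
`P`. Let `L_σ(z)` be the sum of `N ^ c(σγ) z ^ N` over all `N` and all long cycles `γ`, where `c`
counts cycles. Then `(1 - z) ^ (m + 2) L_σ(z) = (m - 1)! z det(1 - zP)` (`longCycleSum_eq`). It is
proved by deleting one point. On the left this gives a sum over the image of the point under `γ`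
(`longCycleSum_option`), where a lost cycle costs a factor `N`, that is, the operator `z d/dz`. On
the right, deletion and multiplication by a transposition are row operations on `1 - zP`; the
resulting minors add up because the all-ones vector is an eigenvector of `P` on both sides and
because `z d/dz` of a determinant is again a sum of minors (`sum_exchange_cycleMatrix`).

For a pairing the determinant is `(1 - z ^ 2) ^ n`, hence `L_α = (2n - 1)! z (1 + z) ^ n / (1 - z) ^
(n + 2)`, whose coefficients are the binomial sum. There are `(2n)! / (2 ^ n n!)` pairings, and for
`n ≥ 1` each class of rooted maps has `(2n - 1)!` labellings, since a relabelling that fixes the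
root and commutes with a long cycle is trivial.

The symmetry under `x ↦ -x` is binomial reciprocity. With the degree bound it forces `n + 1 - v` to
be even and nonnegative, so the genus is a natural number. -/

/-! ### Counting cycles when a point is deleted -/

section CycleCount

variable {α β : Type*}

/-- The number of cycles of a permutation, fixed points included. -/
noncomputable def cycleCount (π : Equiv.Perm α) : ℕ :=
  Nat.card (Quotient (Equiv.Perm.SameCycle.setoid π))

theorem cycleCount_conj (e : α ≃ β) (π : Equiv.Perm α) :
    cycleCount ((e.symm.trans π).trans e) = cycleCount π := by
  refine (Nat.card_congr (Quotient.congr e fun a b => ?_)).symm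
  have key : ∀ k : ℤ, (((e.symm.trans π).trans e) ^ k) (e a) = e ((π ^ k) a) := by
    intro k
    have : ((e.symm.trans π).trans e) ^ k = e.permCongrHom (π ^ k) := by
      rw [map_zpow]; rfl
    rw [this]; simp
  change (∃ k : ℤ, _) ↔ ∃ k : ℤ, _
  simp only [key, e.apply_eq_iff_eq]

theorem sameCycle_some_apply_removeNone (π : Equiv.Perm (Option α)) (x : α) :
    π.SameCycle (some x) (some (Equiv.removeNone π x)) := by
  by_cases h : ∃ y, π (some x) = some y
  · rw [Equiv.removeNone_some π h]
    exact ⟨1, by simp⟩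
  · have h : π (some x) = none := by
      rw [← Option.not_isSome_iff_eq_none, Option.isSome_iff_exists]; exact h
    rw [Equiv.removeNone_none π h]
    exact ⟨2, by rw [zpow_two, Equiv.Perm.mul_apply, h]⟩

theorem sameCycle_some_of_removeNone [Finite α] (π : Equiv.Perm (Option α)) {x y : α}
    (h : Equiv.Perm.SameCycle (Equiv.removeNone π) x y) : π.SameCycle (some x) (some y) := by
  obtain ⟨k, -, rfl⟩ := h.exists_pow_eq'
  induction k with
  | zero => exact Equiv.Perm.SameCycle.refl _ _
  | succ k ih =>
    rw [pow_succ', Equiv.Perm.mul_apply]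
    exact (ih ⟨k, rfl⟩).trans (sameCycle_some_apply_removeNone π _)

theorem sameCycle_removeNone [Finite α] (π : Equiv.Perm (Option α)) {x y : α}
    (h : π.SameCycle (some x) (some y)) : Equiv.Perm.SameCycle (Equiv.removeNone π) x y := by
  obtain ⟨k, -, hk⟩ := h.exists_pow_eq'
  have step : ∀ z : α, Equiv.Perm.SameCycle (Equiv.removeNone π) z (Equiv.removeNone π z) :=
    fun z => ⟨1, by simp⟩
  -- The orbit may stand at `none` after `k` steps; the second clause then records the point reached
  -- next, because `removeNone` jumps over `none`.
  have : ∀ k : ℕ,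
      (∀ y, (π ^ k) (some x) = some y → Equiv.Perm.SameCycle (Equiv.removeNone π) x y) ∧
      ((π ^ k) (some x) = none → ∀ y, π none = some y →
        Equiv.Perm.SameCycle (Equiv.removeNone π) x y) := by
    intro k
    induction k with
    | zero => simpa using Equiv.Perm.SameCycle.refl _ _
    | succ k ih =>
      rw [pow_succ', Equiv.Perm.mul_apply]
      cases hz : (π ^ k) (some x) with
      | none => exact ⟨ih.2 hz, fun h1 y h2 => by simp [h1] at h2⟩
      | some z =>
        have hxz := ih.1 z hz
        refine ⟨fun y hy => ?_, fun hn y hy => ?_⟩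
        · have := Equiv.removeNone_some π ⟨y, hy⟩
          rw [hy, Option.some_inj] at this
          exact hxz.trans (this ▸ step z)
        · have := Equiv.removeNone_none π hn
          rw [hy, Option.some_inj] at this
          exact hxz.trans (this ▸ step z)
  exact (this k).1 y hk

/-- Deleting a point from a permutation of a finite set does not change the number of cycles,
unless the point is fixed. -/
theorem cycleCount_eq_removeNone [Finite α] (π : Equiv.Perm (Option α)) [Decidable (π none = none)] :
    cycleCount π = cycleCount (Equiv.removeNone π) + if π none = none then 1 else 0 := by
  classical
  let f : Quotient (Equiv.Perm.SameCycle.setoid (Equiv.removeNone π)) →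
      Quotient (Equiv.Perm.SameCycle.setoid π) :=
    Quotient.map some fun _ _ h => sameCycle_some_of_removeNone π h
  have hf : Function.Injective f := by
    intro a b
    induction a, b using Quotient.inductionOn₂ with
    | h a b => exact fun h => Quotient.sound (sameCycle_removeNone π (Quotient.exact h))
  unfold cycleCount
  split_ifs with h
  · rw [← Finite.card_option]
    refine (Nat.card_congr (Equiv.ofBijective
      (fun o => o.elim (Quotient.mk (Equiv.Perm.SameCycle.setoid π) none) f) ⟨?_, ?_⟩)).symm
    · have hne : ∀ q, Quotient.mk (Equiv.Perm.SameCycle.setoid π) none ≠ f q := by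
        intro q
        induction q using Quotient.inductionOn with
        | h a =>
          intro hq
          have := Quotient.exact hq
          exact absurd ((Equiv.Perm.SameCycle.eq_of_left this h)) (by simp)
      rintro (_ | a) (_ | b) hab
      · rfl
      · exact absurd hab (hne b)
      · exact absurd hab.symm (hne a)
      · exact congrArg some (hf hab)
    · intro q
      induction q using Quotient.inductionOn with
      | h a =>
        cases a with
        | none => exact ⟨none, rfl⟩
        | some a => exact ⟨some (Quotient.mk _ a), rfl⟩
  · rw [add_zero]
    refine (Nat.card_congr (Equiv.ofBijective f ⟨hf, ?_⟩)).symm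
    intro q
    induction q using Quotient.inductionOn with
    | h a =>
      cases a with
      | none =>
        obtain ⟨y, hy⟩ := Option.ne_none_iff_exists'.1 h
        exact ⟨Quotient.mk _ y, Quotient.sound
          (Equiv.Perm.SameCycle.symm ⟨1, by simpa using hy⟩)⟩
      | some a => exact ⟨Quotient.mk _ a, rfl⟩

theorem cycleCount_pos [Finite α] [Nonempty α] (π : Equiv.Perm α) : 0 < cycleCount π :=
  have : Nonempty (Quotient (Equiv.Perm.SameCycle.setoid π)) := ‹Nonempty α›.map (Quotient.mk _)
  Nat.card_pos

theorem isCycleOn_univ_iff_cycleCount [Nonempty α] (π : Equiv.Perm α) :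
    π.IsCycleOn Set.univ ↔ cycleCount π = 1 := by
  rw [cycleCount, Nat.card_eq_one_iff_unique]
  constructor
  · intro h
    refine ⟨⟨fun a b => ?_⟩, ‹Nonempty α›.map (Quotient.mk _)⟩
    induction a, b using Quotient.inductionOn₂ with
    | h a b => exact Quotient.sound (h.2 (Set.mem_univ a) (Set.mem_univ b))
  · rintro ⟨h, -⟩
    refine ⟨by simpa using π.bijective, fun a _ b _ => ?_⟩
    exact Quotient.exact (s := Equiv.Perm.SameCycle.setoid π) (h.elim _ _)

end CycleCount

/-! ### Derivations of determinants and exchange of two rows -/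

section RowDeterminants

variable {K R J : Type*} [CommRing K] [CommRing R] [Algebra K R] [Fintype J] [DecidableEq J]

theorem Derivation.map_finset_prod {ι : Type*} [DecidableEq ι] (δ : Derivation K R R)
    (s : Finset ι) (f : ι → R) :
    δ (∏ i ∈ s, f i) = ∑ i ∈ s, δ (f i) * ∏ j ∈ s.erase i, f j := by
  induction s using Finset.induction_on with
  | empty => simp
  | insert a s ha ih =>
    rw [Finset.prod_insert ha, Derivation.leibniz, ih, Finset.sum_insert ha,
      Finset.erase_insert ha, smul_eq_mul, smul_eq_mul, Finset.mul_sum, add_comm]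
    congr 1
    · ring
    · refine Finset.sum_congr rfl fun i hi => ?_
      have hia : i ≠ a := fun h => ha (h ▸ hi)
      rw [Finset.erase_insert_of_ne hia.symm, Finset.prod_insert (by simp [ha])]
      ring

/-- A derivation acts on a determinant row by row. -/
theorem Derivation.map_det (δ : Derivation K R R) (M : Matrix J J R) :
    δ M.det = ∑ i, (M.updateRow i fun j => δ (M i j)).det := by
  have h : ∀ i, (M.updateRow i fun j => δ (M i j)).det =
      ∑ σ : Equiv.Perm J, (Equiv.Perm.sign σ : ℤ) •
        (δ (M i (σ i)) * ∏ j ∈ Finset.univ.erase i, M j (σ j)) := by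
    intro i
    rw [← Matrix.det_transpose, Matrix.det_apply]
    refine Finset.sum_congr rfl fun σ _ => ?_
    rw [← Finset.mul_prod_erase _ _ (Finset.mem_univ i)]
    simp only [Matrix.transpose_apply, Matrix.updateRow_self, Units.smul_def]
    congr 2
    refine Finset.prod_congr rfl fun j hj => ?_
    rw [Matrix.updateRow_ne (Finset.ne_of_mem_erase hj)]
  simp_rw [h]
  rw [Finset.sum_comm, ← Matrix.det_transpose, Matrix.det_apply, map_sum]
  refine Finset.sum_congr rfl fun σ _ => ?_
  simp only [Units.smul_def, Matrix.transpose_apply]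
  rw [map_zsmul, Derivation.map_finset_prod, Finset.smul_sum]

/-- The determinant of `M` with the rows `a` and `b` replaced by `u` and `v`. -/
def rowPairDet (M : Matrix J J R) (a b : J) (u v : J → R) : R :=
  ((M.updateRow a u).updateRow b v).det

namespace rowPairDet

variable {M : Matrix J J R} {a b : J}

theorem add_right (u v w : J → R) :
    rowPairDet M a b u (v + w) = rowPairDet M a b u v + rowPairDet M a b u w :=
  Matrix.det_updateRow_add _ _ _ _

theorem smul_right (r : R) (u v : J → R) :
    rowPairDet M a b u (r • v) = r * rowPairDet M a b u v :=
  Matrix.det_updateRow_smul _ _ _ _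

theorem swap (hab : a ≠ b) (u v : J → R) : rowPairDet M a b u v = rowPairDet M b a v u := by
  rw [rowPairDet, rowPairDet, Matrix.updateRow_comm _ hab]

theorem add_left (hab : a ≠ b) (u v w : J → R) :
    rowPairDet M a b (u + v) w = rowPairDet M a b u w + rowPairDet M a b v w := by
  simp only [swap hab, add_right]

theorem smul_left (hab : a ≠ b) (r : R) (u v : J → R) :
    rowPairDet M a b (r • u) v = r * rowPairDet M a b u v := by
  simp only [swap hab, smul_right]

theorem self (hab : a ≠ b) (u : J → R) : rowPairDet M a b u u = 0 :=
  Matrix.det_zero_of_row_eq hab (by simp [Matrix.updateRow_ne hab])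

theorem antisymm (hab : a ≠ b) (u v : J → R) :
    rowPairDet M a b u v = -rowPairDet M a b v u := by
  have h := self (M := M) hab (u + v)
  rw [add_left hab, add_right, add_right, self hab, self hab] at h
  linear_combination h

theorem row_left (v : J → R) : rowPairDet M a b (M a) v = (M.updateRow b v).det := by
  rw [rowPairDet, Matrix.updateRow_eq_self]

theorem row_right (hab : a ≠ b) (u : J → R) :
    rowPairDet M a b u (M b) = (M.updateRow a u).det := by
  rw [swap hab, row_left]

theorem row_row : rowPairDet M a b (M a) (M b) = M.det := by
  rw [row_left, Matrix.updateRow_eq_self]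

/-- Exchange of the rows `a` and `b`, up to multiples of the unit vectors. -/
theorem exchange (hab : a ≠ b) (z : R) :
    rowPairDet M a b (M b + (z • Pi.single a 1 + (-1 : R) • Pi.single b 1))
        (M a + (Pi.single b 1 + (-1 : R) • Pi.single a 1)) =
      -M.det + M.adjugate a a - M.adjugate b a + M.adjugate b b - z * M.adjugate a b -
        (1 - z) * rowPairDet M a b (Pi.single a 1) (Pi.single b 1) := by
  simp only [add_left hab, add_right, smul_left hab, smul_right, self hab]
  rw [antisymm hab (M b) (M a), antisymm hab (M b) (Pi.single b 1),
    antisymm hab (M b) (Pi.single a 1), antisymm hab (Pi.single a 1) (M a),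
    antisymm hab (Pi.single b 1) (M a), antisymm hab (Pi.single b 1) (Pi.single a 1),
    row_row, row_left, row_left, row_right hab, row_right hab]
  simp only [Matrix.adjugate_apply]
  ring

end rowPairDet

theorem Matrix.det_option {α : Type*} [Fintype α] [DecidableEq α]
    (M : Matrix (Option α) (Option α) R) (h : ∀ i, M (some i) none = 0) :
    M.det = M none none * (M.submatrix some some).det := by
  have e := Matrix.det_submatrix_equiv_self (Equiv.optionEquivSumPUnit.{0} α).symm M
  rw [← e, ← Matrix.fromBlocks_toBlocks (M.submatrix _ _)]
  have h0 : (M.submatrix (Equiv.optionEquivSumPUnit.{0} α).symm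
      (Equiv.optionEquivSumPUnit.{0} α).symm).toBlocks₁₂ = 0 := by
    ext i j; simpa [Matrix.toBlocks₁₂] using h i
  rw [h0, Matrix.det_fromBlocks_zero₁₂, mul_comm]
  congr 1
  simp [Matrix.toBlocks₂₂]

end RowDeterminants

/-! ### The matrix `1 - zP` of a permutation -/

section CycleMatrix

variable {R J : Type*} [CommRing R] [DecidableEq J]

/-- The matrix `1 - z P`, where `P` is the permutation matrix of `σ`. -/
def cycleMatrix (z : R) (σ : Equiv.Perm J) : Matrix J J R :=
  Matrix.of fun k => Pi.single k 1 + (-z) • Pi.single (σ k) 1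

theorem cycleMatrix_row (z : R) (σ : Equiv.Perm J) (k : J) :
    cycleMatrix z σ k = Pi.single k 1 + (-z) • Pi.single (σ k) 1 := rfl

theorem cycleMatrix_submatrix {K : Type*} [DecidableEq K] (e : K ≃ J) (z : R)
    (σ : Equiv.Perm J) :
    (cycleMatrix z σ).submatrix e e = cycleMatrix z ((e.trans σ).trans e.symm) := by
  ext i j
  simp [cycleMatrix, Pi.single_apply, Equiv.eq_symm_apply, e.apply_eq_iff_eq]

/-- The rows of `1 - zP` all sum to `1 - z`, so the all-ones vector is an eigenvector; multiplying
by the adjugate gives the claim. -/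
theorem one_sub_mul_sum_adjugate_row [Fintype J] (z : R) (σ : Equiv.Perm J) (a : J) :
    (1 - z) * ∑ b, (cycleMatrix z σ).adjugate a b = (cycleMatrix z σ).det := by
  have h1 : (cycleMatrix z σ).mulVec (fun _ => 1) = fun _ => 1 - z := by
    ext k
    simp [Matrix.mulVec, dotProduct, cycleMatrix, Finset.sum_add_distrib, ← Finset.mul_sum,
      sub_eq_add_neg]
  have h2 := congrFun (congrArg ((cycleMatrix z σ).adjugate.mulVec) h1) a
  rw [Matrix.mulVec_mulVec, Matrix.adjugate_mul] at h2
  simp only [Matrix.smul_apply, Matrix.one_apply, smul_eq_mul, mul_one, Matrix.mulVec, dotProduct,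
    mul_ite, mul_zero, Finset.sum_ite_eq, Finset.mem_univ, if_true] at h2
  rw [h2, Finset.mul_sum]
  exact Finset.sum_congr rfl fun _ _ => mul_comm _ _

theorem one_sub_mul_sum_adjugate_col [Fintype J] (z : R) (σ : Equiv.Perm J) (a : J) :
    (1 - z) * ∑ b, (cycleMatrix z σ).adjugate b a = (cycleMatrix z σ).det := by
  have h1 : Matrix.vecMul (fun _ => 1) (cycleMatrix z σ) = fun _ => 1 - z := by
    ext k
    have : ∑ x, (Pi.single (σ x) (1 : R) : J → R) k = 1 := by
      rw [Equiv.sum_comp σ fun y => (Pi.single y (1 : R) : J → R) k]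
      simp [Pi.single_apply]
    simp only [Matrix.vecMul, dotProduct, cycleMatrix, Matrix.of_apply, Pi.add_apply,
      Pi.smul_apply, one_mul, Finset.sum_add_distrib, ← Finset.smul_sum, this]
    simp [Pi.single_apply, sub_eq_add_neg]
  have h2 := congrFun (congrArg (fun v => Matrix.vecMul v (cycleMatrix z σ).adjugate) h1) a
  simp only [Matrix.vecMul_vecMul, Matrix.mul_adjugate] at h2
  simp only [Matrix.smul_apply, Matrix.one_apply, smul_eq_mul, mul_one, one_mul, Matrix.vecMul,
    dotProduct, mul_ite, mul_zero, Finset.sum_ite_eq', Finset.mem_univ, if_true] at h2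
  rw [h2, Finset.mul_sum]

variable {K : Type*} [CommRing K] [Algebra K R] (δ : Derivation K R R) {z : R}

/-- Only the term `-z` at `σ k` depends on `z`, and `z δ` fixes it. Differentiating a row thus
replaces it by itself minus a unit vector, which turns derivatives into minors. -/
theorem smul_derivation_cycleMatrix_row (hz : δ z = 1) (σ : Equiv.Perm J) (k : J) :
    z • (fun j => δ (cycleMatrix z σ k j)) = cycleMatrix z σ k + (-1 : R) • Pi.single k 1 := by
  ext j
  simp [cycleMatrix, Pi.single_apply]
  split_ifs <;> simp [hz]

variable [Fintype J]

/-- The logarithmic derivative of `det (1 - z P)`. -/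
theorem mul_derivation_det_cycleMatrix (hz : δ z = 1) (σ : Equiv.Perm J) :
    z * δ (cycleMatrix z σ).det =
      Fintype.card J * (cycleMatrix z σ).det - (cycleMatrix z σ).adjugate.trace := by
  rw [Derivation.map_det, Finset.mul_sum]
  simp_rw [← Matrix.det_updateRow_smul, smul_derivation_cycleMatrix_row δ hz,
    Matrix.det_updateRow_add, Matrix.det_updateRow_smul, Matrix.updateRow_eq_self,
    ← Matrix.adjugate_apply]
  simp [Finset.sum_add_distrib, Matrix.trace, sub_eq_add_neg]

theorem mul_derivation_adjugate_cycleMatrix (hz : δ z = 1) (σ : Equiv.Perm J) (a : J) :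
    z * δ ((cycleMatrix z σ).adjugate a a) =
      ∑ b ∈ Finset.univ.erase a, ((cycleMatrix z σ).adjugate a a -
        rowPairDet (cycleMatrix z σ) a b (Pi.single a 1) (Pi.single b 1)) := by
  rw [Matrix.adjugate_apply, Derivation.map_det, Finset.mul_sum,
    ← Finset.add_sum_erase _ _ (Finset.mem_univ a)]
  have h0 : (fun j => δ ((cycleMatrix z σ).updateRow a (Pi.single a 1) a j)) = 0 := by
    ext j
    simp [Pi.single_apply]
    split_ifs <;> simp
  rw [h0, Matrix.det_eq_zero_of_row_eq_zero a (by simp), mul_zero, zero_add]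
  refine Finset.sum_congr rfl fun b hb => ?_
  have hb := Finset.ne_of_mem_erase hb
  rw [← Matrix.det_updateRow_smul, Matrix.updateRow_ne hb, smul_derivation_cycleMatrix_row δ hz,
    Matrix.det_updateRow_add, Matrix.det_updateRow_smul, sub_eq_add_neg, rowPairDet]
  have hrow := Matrix.updateRow_eq_self ((cycleMatrix z σ).updateRow a (Pi.single a 1)) b
  rw [Matrix.updateRow_ne hb] at hrow
  rw [hrow, neg_one_mul]

end CycleMatrix

/-! ### Deleting a point and multiplying by a transposition, as row operations -/

section RemoveNone

variable {R α : Type*} [CommRing R] [Fintype α] [DecidableEq α] (z : R)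

theorem det_cycleMatrix_of_fixed (τ : Equiv.Perm (Option α)) (h : τ none = none) :
    (cycleMatrix z τ).det = (1 - z) * (cycleMatrix z (Equiv.removeNone τ)).det := by
  have hs : ∀ i, some (Equiv.removeNone τ i) = τ (some i) := fun i =>
    Equiv.removeNone_some τ (Option.ne_none_iff_exists'.1 fun h' =>
      by simpa using τ.injective (h'.trans h.symm))
  rw [Matrix.det_option]
  · congr 1
    · simp [cycleMatrix, h, sub_eq_add_neg]
    · congr 1
      ext i j
      simp [cycleMatrix, Pi.single_apply, ← hs]
  · intro i
    simp [cycleMatrix, ← hs]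

/-- The modified row `none` has entry `z` at `none` and `-z` at `τ none`. Added to the row of the
preimage of `none`, it redirects that row to `τ none`, as `removeNone` does, and leaves `z` as the
only entry of the column `none`. -/
theorem det_cycleMatrix_removeNone (τ : Equiv.Perm (Option α)) (h : τ none ≠ none) :
    z * (cycleMatrix z (Equiv.removeNone τ)).det =
      ((cycleMatrix z τ).updateRow none
        (cycleMatrix z τ none + (z - 1) • Pi.single none 1)).det := by
  obtain ⟨a, ha⟩ : ∃ a, τ (some a) = none := by
    obtain ⟨a, ha⟩ := Option.ne_none_iff_exists'.1 (fun h' : τ.symm none = none => h (by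
      rw [Equiv.symm_apply_eq] at h'; exact h'.symm))
    exact ⟨a, by rw [← ha, Equiv.apply_symm_apply]⟩
  rw [← Matrix.det_updateRow_add_self _ (Option.some_ne_none a), Matrix.det_option]
  · congr 1
    · rw [Matrix.updateRow_ne (Option.some_ne_none a).symm]
      simp [cycleMatrix, h.symm]
    · congr 1
      ext i j
      by_cases hi : i = a
      · subst hi
        have := Equiv.removeNone_none τ ha
        simp [cycleMatrix, Pi.single_apply, ha, ← this]
      · have : some (Equiv.removeNone τ i) = τ (some i) :=
          Equiv.removeNone_some τ (Option.ne_none_iff_exists'.1 fun h' =>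
            hi (by simpa using τ.injective (h'.trans ha.symm)))
        simp [Matrix.updateRow_apply, hi, cycleMatrix, Pi.single_apply, ← this]
  · intro i
    by_cases hi : i = a
    · subst hi
      simp [cycleMatrix, ha, h.symm]
    · have : τ (some i) ≠ none := fun h' =>
        hi (by simpa using τ.injective (h'.trans ha.symm))
      simp [Matrix.updateRow_apply, hi, cycleMatrix, this.symm]

/-- The transposition exchanges the off-diagonal terms of two rows but not their diagonal terms; the
unit vectors make up for the difference. -/
theorem updateRow_cycleMatrix_mul_swap (σ : Equiv.Perm (Option α)) (i : α) :
    ((cycleMatrix z (σ * Equiv.swap none (some i))).updateRow none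
      (cycleMatrix z (σ * Equiv.swap none (some i)) none + (z - 1) • Pi.single none 1)).det =
    rowPairDet (cycleMatrix z σ) none (some i)
      (cycleMatrix z σ (some i) + (z • Pi.single none 1 + (-1 : R) • Pi.single (some i) 1))
      (cycleMatrix z σ none + (Pi.single (some i) 1 + (-1 : R) • Pi.single none 1)) := by
  rw [rowPairDet]
  congr 1
  ext k j
  rcases k with _ | k
  · rw [Matrix.updateRow_ne (Option.some_ne_none i).symm]
    simp [cycleMatrix]
    ring
  · by_cases hk : k = i
    · subst hk
      simp [cycleMatrix]
      ring
    · have : Equiv.swap none (some i) (some k) = some k :=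
        Equiv.swap_apply_of_ne_of_ne (by simp) (by simpa using hk)
      simp [Matrix.updateRow_apply, hk, cycleMatrix, this]

end RemoveNone

/-! ### The generating function of coloured products with a long cycle -/

section LongCycleSum

variable {α β : Type*} [Fintype α] [DecidableEq α] [Fintype β] [DecidableEq β]

/-- This is the recursion in determinant form. After `rowPairDet.exchange`, the sums of adjugate
entries in the row and column `none` are known up to the factor `1 - z`, the trace comes from `δ` of
the determinant, and the double minors cancel against `δ` of the adjugate entry. -/
theorem sum_exchange_cycleMatrix {K R : Type*} [CommRing K] [CommRing R] [Algebra K R]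
    (δ : Derivation K R R) {z : R}
    (hz : δ z = 1) (σ : Equiv.Perm (Option α)) :
    (1 - z) * ∑ i : α, rowPairDet (cycleMatrix z σ) none (some i)
        (cycleMatrix z σ (some i) + (z • Pi.single none 1 + (-1 : R) • Pi.single (some i) 1))
        (cycleMatrix z σ none + (Pi.single (some i) 1 + (-1 : R) • Pi.single none 1)) +
      (Fintype.card α + 2) * z *
        ((cycleMatrix z σ).det - (1 - z) * (cycleMatrix z σ).adjugate none none) +
      (1 - z) * z * δ ((cycleMatrix z σ).det - (1 - z) * (cycleMatrix z σ).adjugate none none) =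
    Fintype.card α * z * (cycleMatrix z σ).det := by
  have hrow := one_sub_mul_sum_adjugate_row z σ none
  have hcol := one_sub_mul_sum_adjugate_col z σ none
  have hdet := mul_derivation_det_cycleMatrix δ hz σ
  have hadj := mul_derivation_adjugate_cycleMatrix δ hz σ none
  have herase : ∀ f : Option α → R, ∑ b ∈ Finset.univ.erase none, f b = ∑ i, f (some i) := by
    intro f
    have := Finset.add_sum_erase Finset.univ f (Finset.mem_univ none)
    rw [Fintype.sum_option] at this
    exact add_left_cancel this
  rw [herase] at hadj
  simp only [rowPairDet.exchange (Option.some_ne_none _).symm]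
  simp only [Matrix.trace, Matrix.diag_apply, Fintype.sum_option, Fintype.card_option,
    Finset.sum_add_distrib, Finset.sum_sub_distrib, ← Finset.mul_sum, Finset.sum_const,
    Finset.card_univ, nsmul_eq_mul, Nat.cast_add, Nat.cast_one] at *
  simp only [map_sub, Derivation.leibniz, smul_eq_mul, hz, Derivation.map_one_eq_zero]
  linear_combination (-z) * hrow - hcol + (1 - z) * hdet - (1 - z) ^ 2 * hadj

/-- The generating function, over the number `N` of colours, of the pairs of a long cycle `γ` and
a colouring of the cycles of `σ γ`. -/
noncomputable def longCycleSum (σ : Equiv.Perm α) : PowerSeries ℚ :=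
  PowerSeries.mk fun N =>
    ∑ γ : Equiv.Perm α, if cycleCount γ = 1 then (N : ℚ) ^ cycleCount (σ * γ) else 0

theorem longCycleSum_conj (e : α ≃ β) (σ : Equiv.Perm α) :
    longCycleSum ((e.symm.trans σ).trans e) = longCycleSum σ := by
  ext N
  simp only [longCycleSum, PowerSeries.coeff_mk]
  rw [← Equiv.sum_comp e.permCongr]
  refine Finset.sum_congr rfl fun γ _ => ?_
  have h1 : cycleCount (e.permCongr γ) = cycleCount γ := cycleCount_conj e γ
  have h2 : cycleCount ((e.symm.trans σ).trans e * e.permCongr γ) = cycleCount (σ * γ) := by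
    rw [← cycleCount_conj e (σ * γ)]
    congr 1
    ext x
    simp
  rw [h1, h2]

theorem removeNone_mul_optionCongr {A : Type*} (τ : Equiv.Perm (Option A)) (γ : Equiv.Perm A) :
    Equiv.removeNone (τ * γ.optionCongr) = Equiv.removeNone τ * γ := by
  ext x
  apply Option.some_injective
  rw [Equiv.Perm.mul_apply]
  by_cases h : τ (some (γ x)) = none
  · rw [Equiv.removeNone_none τ h, Equiv.removeNone_none _ (by simpa using h)]
    simp
  · have h' := Option.ne_none_iff_exists'.1 h
    rw [Equiv.removeNone_some τ h', Equiv.removeNone_some _ (by simpa using h')]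
    simp

/-- Every `γ` is uniquely a transposition of `none` with its image, times a permutation of `α`. It
is a long cycle exactly when that image is some `i : α` and the second factor is a long cycle. If
`none` is fixed by the product with `σ`, deleting it loses one cycle, and the factor `N` is the
operator `X d/dX`. -/
theorem longCycleSum_option [Nonempty α] (σ : Equiv.Perm (Option α)) :
    longCycleSum σ = ∑ i : α,
      if (σ * Equiv.swap none (some i)) none = none then
        PowerSeries.X * PowerSeries.derivative ℚ
          (longCycleSum (Equiv.removeNone (σ * Equiv.swap none (some i))))
      else longCycleSum (Equiv.removeNone (σ * Equiv.swap none (some i))) := by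
  ext N
  simp only [map_sum]
  simp only [longCycleSum, PowerSeries.coeff_mk]
  rw [← Equiv.sum_comp Equiv.Perm.decomposeOption.symm, Fintype.sum_prod_type, Fintype.sum_option]
  have hrem : ∀ (x : Option α) (γ : Equiv.Perm α),
      Equiv.removeNone (Equiv.Perm.decomposeOption.symm (x, γ)) = γ := fun x γ =>
    congrArg Prod.snd (Equiv.Perm.decomposeOption.apply_symm_apply (x, γ))
  have hnone : ∀ (x : Option α) (γ : Equiv.Perm α),
      Equiv.Perm.decomposeOption.symm (x, γ) none = x := fun x γ =>
    congrArg Prod.fst (Equiv.Perm.decomposeOption.apply_symm_apply (x, γ))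
  rw [Finset.sum_eq_zero, zero_add]
  · refine Finset.sum_congr rfl fun i _ => ?_
    have hc : ∀ γ : Equiv.Perm α,
        cycleCount (Equiv.Perm.decomposeOption.symm (some i, γ)) = cycleCount γ := by
      intro γ
      rw [cycleCount_eq_removeNone, hrem, hnone]
      simp
    have hd : ∀ γ : Equiv.Perm α,
        cycleCount (σ * Equiv.Perm.decomposeOption.symm (some i, γ)) =
          cycleCount (Equiv.removeNone (σ * Equiv.swap none (some i)) * γ) +
            if (σ * Equiv.swap none (some i)) none = none then 1 else 0 := by
      intro γ
      rw [cycleCount_eq_removeNone, Equiv.Perm.decomposeOption_symm_apply, ← mul_assoc,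
        removeNone_mul_optionCongr]
      simp
    simp only [hc, hd]
    split_ifs with h
    · cases N with
      | zero => simp
      | succ N =>
        rw [PowerSeries.coeff_succ_X_mul, PowerSeries.coeff_derivative, PowerSeries.coeff_mk,
          Finset.sum_mul]
        refine Finset.sum_congr rfl fun γ _ => ?_
        split_ifs <;> simp [pow_succ]
    · simp
  · intro γ _
    rw [if_neg]
    rw [cycleCount_eq_removeNone, hrem, hnone]
    have := cycleCount_pos γ
    simp only [if_true]
    omega

theorem longCycleSum_of_isEmpty [IsEmpty α] (σ : Equiv.Perm (Option α)) :
    (1 - PowerSeries.X) ^ 2 * longCycleSum σ = PowerSeries.X := by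
  have hc : ∀ τ : Equiv.Perm (Option α), cycleCount τ = 1 := by
    intro τ
    have : cycleCount (Equiv.removeNone τ) = 0 := by
      have : IsEmpty (Quotient (Equiv.Perm.SameCycle.setoid (Equiv.removeNone τ))) :=
        ⟨fun q => q.inductionOn fun a => isEmptyElim a⟩
      exact Nat.card_of_isEmpty
    rw [cycleCount_eq_removeNone, this, if_pos (Subsingleton.elim _ _)]
  have h1 : longCycleSum σ =
      PowerSeries.X * PowerSeries.derivative ℚ (PowerSeries.mk (1 : ℕ → ℚ)) := by
    ext N
    simp only [longCycleSum, hc, if_true, PowerSeries.coeff_mk]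
    cases N with
    | zero => simp
    | succ N =>
      rw [PowerSeries.coeff_succ_X_mul, PowerSeries.coeff_derivative, PowerSeries.coeff_mk]
      simp
  have h2 := PowerSeries.mk_one_mul_one_sub_eq_one ℚ
  have h3 := congrArg (PowerSeries.derivative ℚ) h2
  rw [Derivation.leibniz, map_sub, PowerSeries.derivative_X, Derivation.map_one_eq_zero] at h3
  simp only [smul_eq_mul] at h3
  rw [h1]
  linear_combination (1 - PowerSeries.X) * PowerSeries.X * h3 + PowerSeries.X * h2

theorem longCycleSum_option_step [Nonempty α] (σ : Equiv.Perm (Option α))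
    (ih : ∀ τ : Equiv.Perm α, (1 - PowerSeries.X) ^ (Fintype.card α + 2) * longCycleSum τ =
      ((Fintype.card α - 1).factorial : PowerSeries ℚ) * PowerSeries.X *
        (cycleMatrix PowerSeries.X τ).det) :
    (1 - PowerSeries.X) ^ (Fintype.card α + 3) * longCycleSum σ =
      ((Fintype.card α).factorial : PowerSeries ℚ) * PowerSeries.X *
        (cycleMatrix PowerSeries.X σ).det := by
  have hfac : ((Fintype.card α).factorial : PowerSeries ℚ) =
      Fintype.card α * ((Fintype.card α - 1).factorial : PowerSeries ℚ) := by
    rw [← Nat.mul_factorial_pred Fintype.card_ne_zero, Nat.cast_mul]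
  set c : PowerSeries ℚ := ((Fintype.card α - 1).factorial : PowerSeries ℚ) with hc
  set z : PowerSeries ℚ := PowerSeries.X with hzdef
  rw [longCycleSum_option, hfac]
  -- If `σ` fixes `none`, all summands agree and there are `card α` of them. Otherwise exactly one
  -- `i`, the preimage `a` of `none`, yields a derivative.
  by_cases h : σ none = none
  · have hi : ∀ i : α, (σ * Equiv.swap none (some i)) none ≠ none := by
      intro i hi
      rw [Equiv.Perm.mul_apply, Equiv.swap_apply_left] at hi
      simpa using σ.injective (hi.trans h.symm)
    have hr : ∀ i : α, Equiv.removeNone (σ * Equiv.swap none (some i)) = Equiv.removeNone σ := by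
      intro i
      ext x
      apply Option.some_injective
      have hx : σ (some x) ≠ none := fun hx => by simpa using σ.injective (hx.trans h.symm)
      rw [Equiv.removeNone_some σ (Option.ne_none_iff_exists'.1 hx)]
      by_cases hxi : x = i
      · subst hxi
        rw [Equiv.removeNone_none _ (by simpa using h)]
        simp
      · have hs : Equiv.swap none (some i) (some x) = some x :=
          Equiv.swap_apply_of_ne_of_ne (by simp) (by simpa using hxi)
        rw [Equiv.removeNone_some _ (Option.ne_none_iff_exists'.1 (by simpa [hs] using hx))]
        simp [hs]
    simp only [hi, hr, if_false, Finset.sum_const, Finset.card_univ, nsmul_eq_mul]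
    rw [det_cycleMatrix_of_fixed z σ h]
    linear_combination (1 - z) * Fintype.card α * ih (Equiv.removeNone σ)
  · set δ := PowerSeries.derivative ℚ
    have hz : δ z = 1 := PowerSeries.derivative_X
    have hsum := sum_exchange_cycleMatrix δ hz σ
    obtain ⟨a, ha⟩ : ∃ a, σ (some a) = none := by
      obtain ⟨a, ha⟩ := Option.ne_none_iff_exists'.1 (fun h' : σ.symm none = none => h (by
        rw [Equiv.symm_apply_eq] at h'; exact h'.symm))
      exact ⟨a, by rw [← ha, Equiv.apply_symm_apply]⟩
    have hfix : ∀ i : α, (σ * Equiv.swap none (some i)) none = none ↔ i = a := by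
      intro i
      rw [Equiv.Perm.mul_apply, Equiv.swap_apply_left, ← ha, σ.apply_eq_iff_eq, Option.some_inj]
    have hra : Equiv.removeNone (σ * Equiv.swap none (some a)) = Equiv.removeNone σ := by
      ext x
      apply Option.some_injective
      by_cases hxa : x = a
      · subst hxa
        rw [Equiv.removeNone_none _ ha, Equiv.removeNone_some]
        · simp
        · simpa using Option.ne_none_iff_exists'.1 h
      · have hs : Equiv.swap none (some a) (some x) = some x :=
          Equiv.swap_apply_of_ne_of_ne (by simp) (by simpa using hxa)
        have hx : σ (some x) ≠ none := fun hx =>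
          hxa (by simpa using σ.injective (hx.trans ha.symm))
        rw [Equiv.removeNone_some σ (Option.ne_none_iff_exists'.1 hx),
          Equiv.removeNone_some _ (Option.ne_none_iff_exists'.1 (by simpa [hs] using hx))]
        simp [hs]
    have hdet : z * (cycleMatrix z (Equiv.removeNone σ)).det =
        (cycleMatrix z σ).det - (1 - z) * (cycleMatrix z σ).adjugate none none := by
      rw [det_cycleMatrix_removeNone z σ h, Matrix.det_updateRow_add, Matrix.det_updateRow_smul,
        Matrix.updateRow_eq_self, Matrix.adjugate_apply]
      ring
    have hterm : ∀ i : α, (1 - z) ^ (Fintype.card α + 3) *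
        (if (σ * Equiv.swap none (some i)) none = none then
          z * δ
            (longCycleSum (Equiv.removeNone (σ * Equiv.swap none (some i))))
        else longCycleSum (Equiv.removeNone (σ * Equiv.swap none (some i)))) =
        c * ((1 - z) * rowPairDet (cycleMatrix z σ) none (some i)
        (cycleMatrix z σ (some i) + (z • Pi.single none 1 + (-1 : PowerSeries ℚ) • Pi.single (some i) 1))
        (cycleMatrix z σ none + (Pi.single (some i) 1 + (-1 : PowerSeries ℚ) • Pi.single none 1))) +
        if i = a then (1 - z) ^ (Fintype.card α + 3) * (z * δ (longCycleSum (Equiv.removeNone σ)))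
        else 0 := by
      intro i
      rw [← updateRow_cycleMatrix_mul_swap]
      by_cases hia : i = a
      · subst hia
        -- For `i = a` the modified row `none` is zero, so the determinant may be included in the
        -- sum over all `i` at no cost.
        have h0 := (hfix i).2 rfl
        rw [if_pos h0, if_pos rfl, hra, Matrix.det_eq_zero_of_row_eq_zero none]
        · ring
        · intro j
          rw [Matrix.updateRow_self, cycleMatrix_row, h0]
          simp
          ring
      · have h0 : ¬ (σ * Equiv.swap none (some i)) none = none := fun h' => hia ((hfix i).1 h')
        rw [if_neg h0, if_neg hia, ← det_cycleMatrix_removeNone z _ h0]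
        linear_combination (1 - z) * ih (Equiv.removeNone (σ * Equiv.swap none (some i)))
    rw [Finset.mul_sum, Finset.sum_congr rfl fun i _ => hterm i, Finset.sum_add_distrib,
      Finset.sum_ite_eq' Finset.univ a, if_pos (Finset.mem_univ a), ← Finset.mul_sum,
      ← Finset.mul_sum]
    have ih0 := ih (Equiv.removeNone σ)
    rw [mul_assoc, hdet] at ih0
    -- The exceptional summand contains the derivative of the series of `removeNone σ`, so the
    -- induction hypothesis is differentiated as well.
    have hd := congrArg δ ih0
    rw [← hdet] at hd
    rw [Derivation.leibniz, Derivation.leibniz, Derivation.leibniz_pow, hc,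
      Derivation.map_natCast, ← hc, map_sub, Derivation.map_one_eq_zero, hz, hdet] at hd
    simp only [smul_eq_mul, nsmul_eq_mul, Nat.cast_add, Nat.cast_ofNat,
      show Fintype.card α + 2 - 1 = Fintype.card α + 1 from rfl] at hd
    linear_combination c * hsum + (1 - z) * z * hd + (Fintype.card α + 2) * z * ih0

theorem longCycleSum_eq [Nonempty α] (σ : Equiv.Perm α) :
    (1 - PowerSeries.X) ^ (Fintype.card α + 2) * longCycleSum σ =
      ((Fintype.card α - 1).factorial : PowerSeries ℚ) * PowerSeries.X *
        (cycleMatrix PowerSeries.X σ).det := by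
  let P : ∀ (γ : Type _) [Fintype γ], Prop := fun γ _ => ∀ [DecidableEq γ] [Nonempty γ]
    (σ : Equiv.Perm γ), (1 - PowerSeries.X) ^ (Fintype.card γ + 2) * longCycleSum σ =
      ((Fintype.card γ - 1).factorial : PowerSeries ℚ) * PowerSeries.X *
        (cycleMatrix PowerSeries.X σ).det
  suffices h : P α from h σ
  refine Fintype.induction_empty_option (P := P) ?_ ?_ ?_ α
  · intro A B hB e hA _ _ σ
    let _ : Fintype A := Fintype.ofEquiv B e.symm
    classical
    have : Nonempty A := e.nonempty
    have h := hA ((e.trans σ).trans e.symm)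
    have h1 := longCycleSum_conj e.symm σ
    rw [Equiv.symm_symm] at h1
    rw [h1, Fintype.card_congr e, ← cycleMatrix_submatrix, Matrix.det_submatrix_equiv_self] at h
    exact h
  · intro _ h
    exact h.elim fun x => x.elim
  · intro A _ hA
    have key : ∀ [DecidableEq A] (σ : Equiv.Perm (Option A)),
        (1 - PowerSeries.X) ^ (Fintype.card (Option A) + 2) * longCycleSum σ =
        ((Fintype.card (Option A) - 1).factorial : PowerSeries ℚ) * PowerSeries.X *
        (cycleMatrix PowerSeries.X σ).det := by
      intro _ σ
      rw [Fintype.card_option]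
      rcases isEmpty_or_nonempty A with _ | _
      · rw [det_cycleMatrix_of_fixed _ _ (Subsingleton.elim _ _), Matrix.det_isEmpty,
          Fintype.card_eq_zero]
        simp only [Nat.factorial, zero_add, Nat.sub_self, Nat.cast_one]
        linear_combination (1 - PowerSeries.X) * longCycleSum_of_isEmpty σ
      · exact longCycleSum_option_step σ fun τ => hA τ
    intro _ _ σ
    classical
    convert key σ

end LongCycleSum

/-! ### The binomial sum: degree, reciprocity and generating function -/

section ColourPolynomial

/-- The polynomial `∑ₖ (n choose k) ((x + n - k) choose (n + 1))`. -/
noncomputable def colourPolynomial (n : ℕ) : ℚ[X] :=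
  ∑ k ∈ Finset.range (n + 1),
    (n.choose k : ℚ[X]) * Ring.choose (X + (n : ℚ[X]) - (k : ℚ[X])) (n + 1)

theorem eval_natCast_colourPolynomial (n N : ℕ) :
    (colourPolynomial n).eval (N : ℚ) =
      ∑ k ∈ Finset.range (n + 1), (n.choose k : ℚ) * ((N + n - k).choose (n + 1) : ℕ) := by
  rw [colourPolynomial, eval_finsetSum]
  refine Finset.sum_congr rfl fun k hk => ?_
  have hk : k ≤ N + n := by have := Finset.mem_range.1 hk; omega
  rw [eval_mul, eval_natCast]
  congr 1
  have := Ring.map_choose (evalRingHom (N : ℚ)) (X + (n : ℚ[X]) - (k : ℚ[X])) (n + 1)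
  rw [coe_evalRingHom] at this
  rw [this, eval_sub, eval_add, eval_X, eval_natCast, eval_natCast, ← Nat.cast_add,
    ← Nat.cast_sub hk, Ring.choose_natCast]

theorem natDegree_colourPolynomial_le (n : ℕ) : (colourPolynomial n).natDegree ≤ n + 1 := by
  refine natDegree_sum_le_of_forall_le _ _ fun k _ => ?_
  refine natDegree_mul_le.trans ?_
  rw [natDegree_natCast, zero_add]
  have h := Ring.descPochhammer_eq_factorial_smul_choose (X + (n : ℚ[X]) - (k : ℚ[X])) (n + 1)
  rw [← aeval_eq_smeval] at h
  have h1 : (aeval (X + (n : ℚ[X]) - (k : ℚ[X])) (descPochhammer ℤ (n + 1))).natDegree ≤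
      (n + 1) * 1 := by
    have hx : (X + (n : ℚ[X]) - (k : ℚ[X])).natDegree ≤ 1 := by
      compute_degree
    have hcomp : aeval (X + (n : ℚ[X]) - (k : ℚ[X])) (descPochhammer ℤ (n + 1)) =
        ((descPochhammer ℤ (n + 1)).map (Int.castRingHom ℚ)).comp
          (X + (n : ℚ[X]) - (k : ℚ[X])) := by
      rw [comp, eval₂_map, aeval_def]
      congr 1
    rw [hcomp]
    refine natDegree_comp_le.trans (Nat.mul_le_mul (natDegree_map_le.trans ?_) hx)
    rw [descPochhammer_natDegree]
  rw [h, mul_one, nsmul_eq_mul, ← C_eq_natCast, natDegree_C_mul (by positivity)] at h1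
  exact h1

/-- Reflect the sum by `k ↦ n - k` and apply `choose (-y) m = (-1) ^ m * choose (y + m - 1) m` with
`m = n + 1`. -/
theorem colourPolynomial_comp_neg (n : ℕ) :
    (colourPolynomial n).comp (-X) = (-1) ^ (n + 1) * colourPolynomial n := by
  rw [colourPolynomial, ← coe_compRingHom_apply, map_sum, ← Finset.sum_range_reflect,
    Finset.mul_sum]
  refine Finset.sum_congr rfl fun k hk => ?_
  have hk : k ≤ n := by have := Finset.mem_range.1 hk; omega
  have h := Ring.map_choose (compRingHom (-X : ℚ[X]))
    (X + (n : ℚ[X]) - ((n + 1 - 1 - k : ℕ) : ℚ[X])) (n + 1)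
  rw [coe_compRingHom_apply, coe_compRingHom_apply] at h
  rw [coe_compRingHom_apply, mul_comp, natCast_comp, h, Nat.add_sub_cancel, Nat.choose_symm hk, sub_comp, add_comp, X_comp,
    natCast_comp, natCast_comp]
  have h2 : (-X + (n : ℚ[X]) - ((n - k : ℕ) : ℚ[X])) = -((X : ℚ[X]) - (k : ℚ[X])) := by
    rw [Nat.cast_sub hk]; ring
  have h3 : (X : ℚ[X]) - (k : ℚ[X]) + ((n + 1 : ℕ) : ℚ[X]) - 1 =
      X + (n : ℚ[X]) - (k : ℚ[X]) := by push_cast; ring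
  have h4 : ((n + 1 : ℕ) : ℤ).negOnePow = (-1) ^ (n + 1) := by
    rw [Int.negOnePow_def, zpow_natCast]
  rw [h2, Ring.choose_neg, h3, h4, Units.smul_def, zsmul_eq_mul]
  push_cast
  ring

/-- Cancelling `(1 - X) ^ n` leaves `X (1 + X) ^ n / (1 - X) ^ (n + 2)`; the two powers expand into
the two binomial factors. -/
theorem coeff_mul_one_sub_X_pow (n N : ℕ) (f : PowerSeries ℚ) (c : ℚ)
    (hf : (1 - PowerSeries.X) ^ (2 * n + 2) * f =
      PowerSeries.C c * PowerSeries.X * (1 - PowerSeries.X ^ 2) ^ n) :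
    PowerSeries.coeff N f = c * (colourPolynomial n).eval (N : ℚ) := by
  have hne : (1 - PowerSeries.X : PowerSeries ℚ) ≠ 0 := by
    intro h
    have := congrArg PowerSeries.constantCoeff h
    simp at this
  have h1 : (1 - PowerSeries.X) ^ (n + 2) * f =
      PowerSeries.C c * PowerSeries.X * (PowerSeries.X + 1) ^ n := by
    apply mul_left_cancel₀ (pow_ne_zero n hne)
    rw [← mul_assoc, ← pow_add, show n + (n + 2) = 2 * n + 2 by ring, hf,
      show (1 - PowerSeries.X ^ 2 : PowerSeries ℚ) =
        (1 - PowerSeries.X) * (PowerSeries.X + 1) by ring, mul_pow]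
    ring
  have h2 : f = PowerSeries.C c * ∑ k ∈ Finset.range (n + 1), PowerSeries.C (n.choose k : ℚ) *
      (PowerSeries.X ^ (k + 1) *
        PowerSeries.mk fun j => ((n + 1 + j).choose (n + 1) : ℚ)) := by
    have h3 := (PowerSeries.invOneSubPow ℚ (n + 2)).val_inv
    rw [PowerSeries.invOneSubPow_inv_eq_one_sub_pow,
      PowerSeries.invOneSubPow_val_succ_eq_mk_add_choose] at h3
    rw [add_pow] at h1
    have h4 : ∑ k ∈ Finset.range (n + 1), PowerSeries.C (n.choose k : ℚ) *
      (PowerSeries.X ^ (k + 1) *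
        PowerSeries.mk fun j => ((n + 1 + j).choose (n + 1) : ℚ)) =
        PowerSeries.X * (∑ k ∈ Finset.range (n + 1),
          PowerSeries.X ^ k * 1 ^ (n - k) * (n.choose k : PowerSeries ℚ)) *
          PowerSeries.mk fun j => ((n + 1 + j).choose (n + 1) : ℚ) := by
      rw [Finset.mul_sum, Finset.sum_mul]
      refine Finset.sum_congr rfl fun k _ => ?_
      rw [map_natCast]
      ring
    rw [h4]
    linear_combination (-f) * h3 +
      (PowerSeries.mk fun j => ((n + 1 + j).choose (n + 1) : ℚ)) * h1
  rw [h2, PowerSeries.coeff_C_mul, map_sum, eval_natCast_colourPolynomial]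
  congr 1
  refine Finset.sum_congr rfl fun k hk => ?_
  have hk : k ≤ n := by have := Finset.mem_range.1 hk; omega
  rw [PowerSeries.coeff_C_mul, PowerSeries.coeff_X_pow_mul', PowerSeries.coeff_mk]
  congr 1
  split_ifs with h
  · rw [show n + 1 + (N - (k + 1)) = N + n - k by omega]
  -- Here `N ≤ k`, so the upper index `N + n - k` is at most `n`.
  · rw [Nat.choose_eq_zero_of_lt (by omega), Nat.cast_zero]

end ColourPolynomial

/-! ### Pairings: their number and their determinant -/

section FixedPointFreeInvolutions

/-- A fixed-point-free involution of `2 n` points. -/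
def IsPairing {n : ℕ} (a : Equiv.Perm (Fin (2 * n))) : Prop :=
  (∀ i, a (a i) = i) ∧ ∀ i, a i ≠ i

theorem isPairing_iff_cycleType {n : ℕ} (a : Equiv.Perm (Fin (2 * n))) :
    IsPairing a ↔ a.cycleType = Multiset.replicate n 2 := by
  have hsupp : a.support = Finset.univ ↔ ∀ i, a i ≠ i := by
    simp [Finset.eq_univ_iff_forall]
  have hsum := a.sum_cycleType
  constructor
  · rintro ⟨h1, h2⟩
    have h3 := Equiv.Perm.cycleType_of_pow_prime_eq_one (σ := a) (p := 2)
      (by ext i; simp [pow_two, h1])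
    rw [h3, hsupp.2 h2] at hsum
    simp only [Multiset.sum_replicate, smul_eq_mul, Finset.card_univ, Fintype.card_fin] at hsum
    rw [h3, show a.cycleType.card = n by omega]
  · intro h
    have h1 : a ^ 2 = 1 := Equiv.Perm.pow_prime_eq_one_iff.2 fun c hc => by
      rw [h] at hc; exact Multiset.eq_of_mem_replicate hc
    refine ⟨fun i => by simpa [pow_two] using Equiv.congr_fun h1 i, hsupp.1 ?_⟩
    rw [← Finset.card_eq_iff_eq_univ, ← hsum, h]
    simp [mul_comm]

theorem card_isPairing (n : ℕ) [DecidablePred (IsPairing (n := n))] :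
    ((Finset.univ.filter (IsPairing (n := n))).card : ℚ) =
      (2 * n).factorial / (2 ^ n * n.factorial) := by
  have h := Equiv.Perm.card_of_cycleType_mul_eq (Fin (2 * n)) (Multiset.replicate n 2)
  rw [if_pos ⟨by simp [mul_comm], fun a ha => (Multiset.eq_of_mem_replicate ha).ge⟩] at h
  have h2 : ∏ k ∈ (Multiset.replicate n 2).toFinset, ((Multiset.replicate n 2).count k).factorial =
      n.factorial := by
    rcases Nat.eq_zero_or_pos n with rfl | hn
    · simp
    · rw [Multiset.toFinset_replicate, if_neg hn.ne']
      simp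
  rw [h2] at h
  simp only [Multiset.sum_replicate, Multiset.prod_replicate, smul_eq_mul, Fintype.card_fin,
    mul_comm n 2, Nat.sub_self, Nat.factorial_zero, one_mul] at h
  rw [eq_div_iff (by positivity)]
  have h3 : Finset.univ.filter (IsPairing (n := n)) =
      ({g | g.cycleType = Multiset.replicate n 2} : Finset (Equiv.Perm (Fin (2 * n)))) := by
    ext a; simp [isPairing_iff_cycleType]
  rw [h3]
  exact_mod_cast h

theorem det_cycleMatrix_prodCongr_swap {R : Type*} [CommRing R] (z : R) (n : ℕ) :
    (cycleMatrix z ((Equiv.swap (0 : Fin 2) 1).prodCongr (Equiv.refl (Fin n)))).det =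
      (1 - z ^ 2) ^ n := by
  have h : cycleMatrix z ((Equiv.swap (0 : Fin 2) 1).prodCongr (Equiv.refl (Fin n))) =
      Matrix.blockDiagonal fun _ : Fin n => cycleMatrix z (Equiv.swap (0 : Fin 2) 1) := by
    ext ⟨i, k⟩ ⟨j, l⟩
    by_cases hkl : k = l
    · subst hkl
      simp [cycleMatrix, Pi.single_apply, Matrix.blockDiagonal_apply]
    · simp [cycleMatrix, Matrix.blockDiagonal_apply, hkl, Ne.symm hkl]
  rw [h, Matrix.det_blockDiagonal]
  have h2 : (cycleMatrix z (Equiv.swap (0 : Fin 2) 1)).det = 1 - z ^ 2 := by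
    rw [Matrix.det_fin_two]
    simp [cycleMatrix]
    ring
  simp [h2]

/-- All pairings have the same cycle type and so are conjugate; it suffices to treat the one that
swaps two copies of `Fin n`, whose matrix is block diagonal. -/
theorem det_cycleMatrix_of_isPairing {R : Type*} [CommRing R] (z : R) {n : ℕ}
    {a : Equiv.Perm (Fin (2 * n))} (ha : IsPairing a) :
    (cycleMatrix z a).det = (1 - z ^ 2) ^ n := by
  let e : Fin 2 × Fin n ≃ Fin (2 * n) := finProdFinEquiv
  let s := (Equiv.swap (0 : Fin 2) 1).prodCongr (Equiv.refl (Fin n))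
  let b : Equiv.Perm (Fin (2 * n)) := (e.symm.trans s).trans e
  have hb : IsPairing b := by
    refine ⟨fun i => ?_, fun i => ?_⟩
    · have hs : ∀ p, s (s p) = p := fun p => by ext <;> simp [s]
      simp only [b, Equiv.trans_apply, Equiv.symm_apply_apply, hs, Equiv.apply_symm_apply]
    · intro h
      have h' : s (e.symm i) = e.symm i := e.injective (by simpa [b] using h)
      have h2 := congrArg Prod.fst h'
      simp only [s, Equiv.prodCongr_apply, Prod.map_fst] at h2
      generalize (e.symm i).1 = x at h2
      revert x
      decide
  have hconj : IsConj b a := Equiv.Perm.isConj_iff_cycleType_eq.2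
    (((isPairing_iff_cycleType b).1 hb).trans ((isPairing_iff_cycleType a).1 ha).symm)
  obtain ⟨c, hc⟩ := isConj_iff.1 hconj
  have h1 := cycleMatrix_submatrix c z a
  have h2 : (c.trans a).trans c.symm = b := by
    ext x
    simp [← hc]
  have h3 := cycleMatrix_submatrix e z b
  have h4 : (e.trans b).trans e.symm = s := by
    ext x <;> simp [b]
  rw [h2] at h1
  rw [h4] at h3
  rw [← Matrix.det_submatrix_equiv_self c, h1, ← Matrix.det_submatrix_equiv_self e, h3,
    det_cycleMatrix_prodCongr_swap]

/-- The number of coloured pairs of a pairing and a long cycle. -/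
theorem sum_isPairing_sum_longCycle {n : ℕ} (hn : 0 < n) (N : ℕ)
    [DecidablePred (IsPairing (n := n))] :
    ∑ a : Equiv.Perm (Fin (2 * n)), (if IsPairing a then
      ∑ γ : Equiv.Perm (Fin (2 * n)),
        if cycleCount γ = 1 then (N : ℚ) ^ cycleCount (a * γ) else 0 else 0) =
      (2 * n - 1).factorial * ((2 * n).factorial / (2 ^ n * n.factorial) *
        (colourPolynomial n).eval (N : ℚ)) := by
  have : Nonempty (Fin (2 * n)) := ⟨⟨0, by omega⟩⟩
  have h : ∀ a : Equiv.Perm (Fin (2 * n)), IsPairing a →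
      (∑ γ : Equiv.Perm (Fin (2 * n)),
        if cycleCount γ = 1 then (N : ℚ) ^ cycleCount (a * γ) else 0) =
      (2 * n - 1).factorial * (colourPolynomial n).eval (N : ℚ) := by
    intro a ha
    have h1 := longCycleSum_eq a
    rw [det_cycleMatrix_of_isPairing _ ha, Fintype.card_fin,
      ← map_natCast (PowerSeries.C (R := ℚ))] at h1
    rw [← coeff_mul_one_sub_X_pow n N _ _ h1, longCycleSum, PowerSeries.coeff_mk]
  rw [← Finset.sum_filter, Finset.sum_congr rfl fun a ha => h a (Finset.mem_filter.1 ha).2,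
    Finset.sum_const, nsmul_eq_mul, card_isPairing]
  ring

end FixedPointFreeInvolutions

/-! ### From labelled maps to classes of rooted maps -/

namespace RootedOneFaceMap

variable {n : ℕ}

theorem ext_α_γ {M N : RootedOneFaceMap n} (hα : M.α = N.α) (hγ : M.γ = N.γ) : M = N := by
  have hβ : M.β = N.β := mul_left_cancel (a := M.α) (by rw [← M.γ_eq, hα, ← N.γ_eq, hγ])
  cases M; cases N
  simp only at hα hβ hγ
  subst hα hβ hγ
  rfl

theorem isPairing_α (M : RootedOneFaceMap n) : IsPairing M.α :=
  ⟨M.α_involutive, M.α_fixedPointFree⟩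

theorem β_eq (M : RootedOneFaceMap n) : M.β = M.α * M.γ := by
  rw [M.γ_eq]
  ext i
  simp [M.α_involutive]

/-- A rooted one-face map is a pairing together with a long cycle. -/
def equivPairs (n : ℕ) : RootedOneFaceMap n ≃
    {p : Equiv.Perm (Fin (2 * n)) × Equiv.Perm (Fin (2 * n)) //
      IsPairing p.1 ∧ p.2.IsCycleOn Set.univ} where
  toFun M := ⟨(M.α, M.γ), M.isPairing_α, M.γ_longCycle⟩
  invFun p :=
    { α := p.1.1
      β := p.1.1 * p.1.2
      γ := p.1.2
      α_involutive := p.2.1.1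
      α_fixedPointFree := p.2.1.2
      γ_eq := by ext i; simp [p.2.1.1]
      γ_longCycle := p.2.2 }
  left_inv M := ext_α_γ rfl rfl
  right_inv _ := rfl

instance : Finite (RootedOneFaceMap n) := Finite.of_equiv _ (equivPairs n).symm

/-- The relabelling of the half-edges by `π`. -/
def relabel (π : Equiv.Perm (Fin (2 * n))) (M : RootedOneFaceMap n) : RootedOneFaceMap n where
  α := π * M.α * π⁻¹
  β := π * M.β * π⁻¹
  γ := π * M.γ * π⁻¹
  α_involutive i := by simp [M.α_involutive]
  α_fixedPointFree i h := M.α_fixedPointFree (π⁻¹ i) (by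
    rw [Equiv.Perm.eq_inv_iff_eq]; exact h)
  γ_eq := by rw [M.γ_eq]; group
  γ_longCycle := by simpa using M.γ_longCycle.conj (g := π)

theorem equivalent_iff_relabel (M N : RootedOneFaceMap n) : M.Equivalent N ↔
    ∃ π : Equiv.Perm (Fin (2 * n)), (∀ i : Fin (2 * n), (i : ℕ) = 0 → π i = i) ∧
      M.relabel π = N := by
  constructor
  · rintro ⟨π, hα, hγ, h0⟩
    exact ⟨π, h0, ext_α_γ hα.symm hγ.symm⟩
  · rintro ⟨π, h0, rfl⟩
    exact ⟨π, rfl, rfl, h0⟩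

theorem numVertices_relabel (π : Equiv.Perm (Fin (2 * n))) (M : RootedOneFaceMap n) :
    (M.relabel π).numVertices = M.numVertices := by
  unfold numVertices
  split_ifs
  · rfl
  · exact cycleCount_conj π M.β

/-- The permutation `ρ⁻¹ * π` commutes with `γ` and fixes the root; as the powers of `γ` carry the
root to every half-edge, it fixes them all. -/
theorem relabel_injective (hn : 0 < n) (M : RootedOneFaceMap n)
    {π ρ : Equiv.Perm (Fin (2 * n))} (hπ : ∀ i : Fin (2 * n), (i : ℕ) = 0 → π i = i)
    (hρ : ∀ i : Fin (2 * n), (i : ℕ) = 0 → ρ i = i) (h : M.relabel π = M.relabel ρ) : π = ρ := by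
  let o : Fin (2 * n) := ⟨0, by omega⟩
  have hγ : π * M.γ * π⁻¹ = ρ * M.γ * ρ⁻¹ := congrArg RootedOneFaceMap.γ h
  have hcomm : Commute (ρ⁻¹ * π) M.γ := by
    change ρ⁻¹ * π * M.γ = M.γ * (ρ⁻¹ * π)
    calc ρ⁻¹ * π * M.γ = ρ⁻¹ * (π * M.γ * π⁻¹) * π := by group
      _ = M.γ * (ρ⁻¹ * π) := by rw [hγ]; group
  have ho : (ρ⁻¹ * π) o = o := by
    rw [Equiv.Perm.mul_apply, hπ o rfl, Equiv.Perm.inv_eq_iff_eq, hρ o rfl]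
  ext i
  obtain ⟨k, rfl⟩ := M.γ_longCycle.2 (Set.mem_univ o) (Set.mem_univ i)
  have h1 := Equiv.congr_fun (hcomm.zpow_right k).eq o
  rw [Equiv.Perm.mul_apply, Equiv.Perm.mul_apply (M.γ ^ k), ho, Equiv.Perm.mul_apply,
    Equiv.Perm.inv_eq_iff_eq] at h1
  rw [h1]

theorem card_rootFixing (hn : 0 < n) :
    Nat.card {π : Equiv.Perm (Fin (2 * n)) // ∀ i : Fin (2 * n), (i : ℕ) = 0 → π i = i} =
      (2 * n - 1).factorial := by
  let p : Fin (2 * n) → Prop := fun i => (i : ℕ) ≠ 0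
  have e := Equiv.Perm.subtypeEquivSubtypePerm p
  have e' : {π : Equiv.Perm (Fin (2 * n)) // ∀ i, ¬ p i → π i = i} ≃
      {π : Equiv.Perm (Fin (2 * n)) // ∀ i : Fin (2 * n), (i : ℕ) = 0 → π i = i} :=
    Equiv.subtypeEquivRight fun π => by simp [p]
  rw [← Nat.card_congr (e.trans e'), Nat.card_perm]
  congr 1
  rw [Nat.card_eq_fintype_card]
  have h := Fintype.card_subtype_compl fun i : Fin (2 * n) => (i : ℕ) = 0
  have h1 : Fintype.card {i : Fin (2 * n) // (i : ℕ) = 0} = 1 := by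
    rw [Fintype.card_eq_one_iff]
    exact ⟨⟨⟨0, by omega⟩, rfl⟩, fun y => Subtype.ext (Fin.ext y.2)⟩
  rw [h1, Fintype.card_fin] at h
  exact h

/-- The number of vertices of a class of equivalent maps. -/
noncomputable def classVertices : Quotient (equivSetoid n) → ℕ :=
  Quotient.lift numVertices fun M N h => by
    obtain ⟨π, -, rfl⟩ := (equivalent_iff_relabel M N).1 h
    exact (numVertices_relabel π M).symm

instance : Finite (Quotient (equivSetoid n)) := Quotient.finite _

theorem card_equivalent (hn : 0 < n) (M : RootedOneFaceMap n) :
    Nat.card {N : RootedOneFaceMap n // (Quotient.mk (equivSetoid n) N) = Quotient.mk _ M} =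
      (2 * n - 1).factorial := by
  rw [← card_rootFixing hn]
  refine (Nat.card_congr (Equiv.ofBijective
    (fun π => ⟨M.relabel π.1, Quotient.sound (equivalent_equivalence.symm
      ((equivalent_iff_relabel _ _).2 ⟨π.1, π.2, rfl⟩))⟩) ⟨?_, ?_⟩)).symm
  · intro π ρ h
    exact Subtype.ext (M.relabel_injective hn π.2 ρ.2 (congrArg Subtype.val h))
  · rintro ⟨N, hN⟩
    obtain ⟨π, h0, h⟩ := (equivalent_iff_relabel M N).1 (Quotient.exact hN.symm)
    exact ⟨⟨π, h0⟩, Subtype.ext h⟩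

theorem sum_numVertices_eq [Fintype (RootedOneFaceMap n)] [Fintype (Quotient (equivSetoid n))]
    (hn : 0 < n) (f : ℕ → ℚ) :
    ∑ M : RootedOneFaceMap n, f M.numVertices =
      (2 * n - 1).factorial * ∑ c : Quotient (equivSetoid n), f (classVertices c) := by
  classical
  rw [← Finset.sum_fiberwise Finset.univ (Quotient.mk (equivSetoid n)), Finset.mul_sum]
  refine Finset.sum_congr rfl fun c _ => ?_
  induction c using Quotient.inductionOn with
  | h M =>
    have h : ∀ N ∈ Finset.univ.filter fun N : RootedOneFaceMap n =>
        Quotient.mk (equivSetoid n) N = Quotient.mk (equivSetoid n) M,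
        f N.numVertices = f (classVertices (Quotient.mk (equivSetoid n) M)) := by
      intro N hN
      rw [← (Finset.mem_filter.1 hN).2]
      rfl
    rw [Finset.sum_congr rfl h, Finset.sum_const, nsmul_eq_mul, ← card_equivalent hn M,
      Nat.card_eq_fintype_card, Fintype.card_subtype]

theorem sum_pow_numVertices [Fintype (RootedOneFaceMap n)] (hn : 0 < n) (N : ℕ) :
    ∑ M : RootedOneFaceMap n, (N : ℚ) ^ M.numVertices =
      (2 * n - 1).factorial * ((2 * n).factorial / (2 ^ n * n.factorial) *
        (colourPolynomial n).eval (N : ℚ)) := by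
  classical
  have : Nonempty (Fin (2 * n)) := ⟨⟨0, by omega⟩⟩
  rw [← sum_isPairing_sum_longCycle hn N]
  have h1 : ∀ M : RootedOneFaceMap n,
      (N : ℚ) ^ M.numVertices = (N : ℚ) ^ cycleCount (M.α * M.γ) := by
    intro M
    rw [numVertices, if_neg hn.ne', ← M.β_eq]
    rfl
  simp only [h1]
  rw [← Equiv.sum_comp (equivPairs n).symm]
  change ∑ p : {p : Equiv.Perm (Fin (2 * n)) × Equiv.Perm (Fin (2 * n)) //
      IsPairing p.1 ∧ p.2.IsCycleOn Set.univ}, (N : ℚ) ^ cycleCount (p.1.1 * p.1.2) = _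
  rw [← Finset.sum_subtype (Finset.univ.filter
      fun p : Equiv.Perm (Fin (2 * n)) × Equiv.Perm (Fin (2 * n)) =>
        IsPairing p.1 ∧ p.2.IsCycleOn Set.univ) (by simp)
      (fun p : Equiv.Perm (Fin (2 * n)) × Equiv.Perm (Fin (2 * n)) =>
        (N : ℚ) ^ cycleCount (p.1 * p.2)), Finset.sum_filter, Fintype.sum_prod_type]
  refine Finset.sum_congr rfl fun a _ => ?_
  simp only [isCycleOn_univ_iff_cycleCount]
  split_ifs with ha
  · simp [ha]
  · simp [ha]

/-- Counting coloured maps: the Harer–Zagier formula at the natural numbers. -/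
theorem sum_pow_classVertices [Fintype (Quotient (equivSetoid n))] (N : ℕ) :
    ∑ c : Quotient (equivSetoid n), (N : ℚ) ^ classVertices c =
      (2 * n).factorial / (2 ^ n * n.factorial) * (colourPolynomial n).eval (N : ℚ) := by
  rcases Nat.eq_zero_or_pos n with rfl | hn
  -- Without half-edges there is no root to fix, and the vertex count is `1` by convention; both
  -- sides equal `N`.
  · have hM : ∀ M N : RootedOneFaceMap 0, M = N := fun M N =>
      ext_α_γ (Equiv.ext fun i => i.elim0) (Equiv.ext fun i => i.elim0)
    let M : RootedOneFaceMap 0 :=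
      { α := 1, β := 1, γ := 1, α_involutive := fun i => i.elim0
        α_fixedPointFree := fun i => i.elim0, γ_eq := rfl
        γ_longCycle := ⟨by simp,
          fun i => i.elim0⟩ }
    have huniv : ∀ c : Quotient (equivSetoid 0), c = Quotient.mk _ M := fun c => by
      induction c using Quotient.inductionOn with
      | h K => rw [hM K M]
    rw [Fintype.sum_eq_single _ fun c hc => absurd (huniv c) hc, eval_natCast_colourPolynomial]
    have : classVertices (Quotient.mk (equivSetoid 0) M) = 1 := rfl
    simp [this]
  · have : Fintype (RootedOneFaceMap n) := Fintype.ofFinite _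
    have h := sum_pow_numVertices hn N
    rw [sum_numVertices_eq hn fun v => (N : ℚ) ^ v] at h
    exact mul_left_cancel₀ (by positivity) h

theorem sum_X_pow_classVertices [Fintype (Quotient (equivSetoid n))] :
    ∑ c : Quotient (equivSetoid n), (X : ℚ[X]) ^ classVertices c =
      C (((2 * n).factorial : ℚ) / (2 ^ n * (n.factorial : ℚ))) * colourPolynomial n := by
  refine eq_of_infinite_eval_eq _ _
    ((Set.infinite_range_of_injective (Nat.cast_injective (R := ℚ))).mono ?_)
  rintro _ ⟨N, rfl⟩
  change eval _ _ = eval _ _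
  rw [eval_finsetSum, eval_C_mul, ← sum_pow_classVertices]
  simp

theorem classVertices_pos (c : Quotient (equivSetoid n)) : 0 < classVertices c := by
  induction c using Quotient.inductionOn with
  | h M =>
    change 0 < M.numVertices
    unfold numVertices
    split_ifs with hn
    · exact one_pos
    · have : Nonempty (Fin (2 * n)) := ⟨⟨0, by omega⟩⟩
      exact cycleCount_pos M.β

/-- Each coefficient counts classes, so nothing cancels: properties of the support of the polynomial
become properties of every single map. -/
theorem coeff_sum_X_pow_classVertices_pos [Fintype (Quotient (equivSetoid n))]
    (c : Quotient (equivSetoid n)) :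
    0 < (∑ c : Quotient (equivSetoid n), (X : ℚ[X]) ^ classVertices c).coeff
      (classVertices c) := by
  rw [finsetSum_coeff]
  refine Finset.sum_pos' (fun d _ => ?_) ⟨c, Finset.mem_univ c, ?_⟩
  · rw [coeff_X_pow]
    split_ifs <;> norm_num
  · rw [coeff_X_pow, if_pos rfl]
    exact one_pos

/-- Euler's formula for one-face maps, with a genus that is a natural number. -/
theorem exists_genus (c : Quotient (equivSetoid n)) :
    ∃ g, 2 * g ≤ n ∧ classVertices c = n + 1 - 2 * g := by
  have : Fintype (Quotient (equivSetoid n)) := Fintype.ofFinite _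
  have hc := coeff_sum_X_pow_classVertices_pos c
  rw [sum_X_pow_classVertices, coeff_C_mul] at hc
  have hne : (colourPolynomial n).coeff (classVertices c) ≠ 0 := fun h => by
    rw [h, mul_zero] at hc; exact lt_irrefl _ hc
  have hle : classVertices c ≤ n + 1 :=
    (le_natDegree_of_ne_zero hne).trans (natDegree_colourPolynomial_le n)
  -- Comparing the coefficients at the number of vertices `v` in the reciprocity law gives `(-1) ^ v
  -- = (-1) ^ (n + 1)`.
  have hparity := congrArg (fun p => coeff p (classVertices c)) (colourPolynomial_comp_neg n)
  have hpow : ((-1) ^ (n + 1) : ℚ[X]) = C ((-1) ^ (n + 1)) := by simp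
  have hneg : (-X : ℚ[X]) = C (-1) * X := by simp
  simp only [hpow, coeff_C_mul, hneg, comp_C_mul_X_coeff] at hparity
  have hpos := classVertices_pos c
  have heven : Even (n + 1 - classVertices c) := by
    have h1 := mul_right_cancel₀ hne ((mul_comm _ _).trans hparity)
    rw [Nat.even_sub hle]
    rcases Nat.even_or_odd (classVertices c) with hv | hv <;>
      rcases Nat.even_or_odd (n + 1) with hn | hn
    · simp [hv, hn]
    · rw [hv.neg_one_pow, hn.neg_one_pow] at h1; norm_num at h1
    · rw [hv.neg_one_pow, hn.neg_one_pow] at h1; norm_num at h1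
    · simp [Nat.not_even_iff_odd.2 hv, Nat.not_even_iff_odd.2 hn]
  obtain ⟨g, hg⟩ := heven
  exact ⟨g, by omega, by omega⟩

theorem setOf_hasGenus_eq (g : ℕ) :
    {c : Quotient (equivSetoid n) | ∃ M : RootedOneFaceMap n, M.HasGenus g ∧ Quotient.mk _ M = c} =
      {c | (classVertices c : ℤ) - n + 1 = 2 - 2 * g} := by
  ext c
  induction c using Quotient.inductionOn with
  | h M =>
    constructor
    · rintro ⟨N, hN, hNM⟩
      rw [← hNM]
      exact hN
    · exact fun h => ⟨M, h, rfl⟩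

end RootedOneFaceMap

/-! ### The genus polynomial -/

open RootedOneFaceMap in
theorem oneFaceMapCount_eq_zero {n g : ℕ} (h : n < 2 * g) : oneFaceMapCount n g = 0 := by
  rw [oneFaceMapCount, setOf_hasGenus_eq, Set.ncard_eq_zero, Set.eq_empty_iff_forall_notMem]
  intro c hc
  have := classVertices_pos c
  simp only [Set.mem_ofPred_eq] at hc
  omega

open RootedOneFaceMap in
-- By `exists_genus`, halving `n + 1 - v` loses nothing, so the classes can be grouped by this
-- number, which is their genus.
theorem genusPolynomial_eq_sum_X_pow (n : ℕ) [Fintype (Quotient (equivSetoid n))] :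
    genusPolynomial n = ∑ c : Quotient (equivSetoid n), (X : ℚ[X]) ^ classVertices c := by
  classical
  have hmaps : ∀ c ∈ (Finset.univ : Finset (Quotient (equivSetoid n))),
      (n + 1 - classVertices c) / 2 ∈ Finset.range (n / 2 + 1) := by
    intro c _
    obtain ⟨g, hg, hc⟩ := exists_genus c
    rw [Finset.mem_range]
    omega
  rw [genusPolynomial, ← Finset.sum_fiberwise_of_maps_to hmaps]
  refine Finset.sum_congr rfl fun g hg => ?_
  have hg : 2 * g ≤ n := by
    have := Finset.mem_range.1 hg
    omega
  have hfiber : ∀ c : Quotient (equivSetoid n),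
      (n + 1 - classVertices c) / 2 = g ↔ classVertices c = n + 1 - 2 * g := by
    intro c
    obtain ⟨k, hk, hc⟩ := exists_genus c
    omega
  have hset : {c : Quotient (equivSetoid n) | (classVertices c : ℤ) - n + 1 = 2 - 2 * g} =
      (Finset.univ.filter fun c : Quotient (equivSetoid n) =>
        (n + 1 - classVertices c) / 2 = g : Finset (Quotient (equivSetoid n))) := by
    ext c
    simp only [Set.mem_ofPred_eq, Finset.coe_filter, Finset.mem_univ, true_and, hfiber]
    omega
  rw [oneFaceMapCount, setOf_hasGenus_eq, hset, Set.ncard_coe_finset, ← nsmul_eq_mul,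
    ← Finset.sum_const]
  refine Finset.sum_congr rfl fun c hc => ?_
  rw [(hfiber c).1 (Finset.mem_filter.1 hc).2]

theorem theoremL (n : ℕ) :
    -- no map with `n` edges has a genus `g` with `2 g > n`: the sum defining `A_n` omits nothing
    (∀ g : ℕ, n < 2 * g → oneFaceMapCount n g = 0) ∧
    genusPolynomial n =
      C (((2 * n).factorial : ℚ) / (2 ^ n * (n.factorial : ℚ))) *
        ∑ k ∈ Finset.range (n + 1),
          (n.choose k : ℚ[X]) * Ring.choose (X + (n : ℚ[X]) - (k : ℚ[X])) (n + 1) ∧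
    (genusPolynomial n).comp (-X) = (-1) ^ (n + 1) * genusPolynomial n := by
  have : Fintype (Quotient (RootedOneFaceMap.equivSetoid n)) := Fintype.ofFinite _
  have h : genusPolynomial n =
      C (((2 * n).factorial : ℚ) / (2 ^ n * (n.factorial : ℚ))) * colourPolynomial n :=
    (genusPolynomial_eq_sum_X_pow n).trans RootedOneFaceMap.sum_X_pow_classVertices
  refine ⟨fun g hg => oneFaceMapCount_eq_zero hg, h, ?_⟩
  rw [h, mul_comp, C_comp, colourPolynomial_comp_neg]
  ring
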